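/- Let $A\in\mathbb R^{n\times n}$, $B\in\mathbb R^{n\times r}$, $C\in\mathbb R^{r\times n}$ with $r\ge 1$ be the matrices of a system $\dot x=Ax+Bu$, $y=Cx$ with equally many inputs and outputs. Assume that $(A,B)$ is controllable, i.e. $\operatorname{rank}[B,AB,\dots,A^{n-1}B]=n$, and that $\det(CB)\neq 0$. Notation. The system zeros are the complex zeros, with multiplicity, of the greatest common divisor $\psi(s)$ of the not identically zero minors of maximal order $n+k$ of $P(s)=\begin{bmatrix} sI_n-A&-B\\ C&O\end{bmatrix}$ that contain the first $n$ rows and the first $n$ columns. Let $\nu$ be the controllability index, the least integer with $\operatorname{rank}[B,\dots,A^{\nu-1}B]=\operatorname{rank}[B,\dots,A^{n-1}B]$, and for $1\le i\le\nu$ let $l_i=\operatorname{rank}[B,\dots,A^{\nu-i}B]-\operatorname{rank}[B,\dots,A^{\nu-i-1}B]$ (the last rank being $0$ for $i=\nu$), so that $l_1\le\dots\le l_\nu=r$ and $l_1+\dots+l_\nu=n$; put $l_0=0$. A reduction of $(A,B)$ to Yokoyama's canonical form is a pair $(N,M)$, with $N\in\mathbb R^{n\times n}$ nonsingular and $M$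 an $r\times r$ permutation matrix, such that, with respect to the partition $n=l_1+\dots+l_\nu$: * for $i=1,\dots,\nu-1$ the $i$-th block row of $NAN^{-1}$ has the $l_i\times l_{i+1}$ block $E_{i,i+1}=[O,I_{l_i}]$ in block column $i+1$ and zeros elsewhere (the last block row is arbitrary); * $NBM=\begin{bmatrix}O\\ G_\nu\end{bmatrix}$, where $G_\nu$ is an $r\times r$ block lower triangular matrix whose diagonal blocks are identity matrices of orders $l_\nu-l_{\nu-1},\ l_{\nu-1}-l_{\nu-2},\dots,\ l_2-l_1,\ l_1$. For such a reduction write $CN^{-1}=[C_1,\dots,C_\nu]$ with $C_i$ of size $r\times l_i$, and let $$\tilde C(s)=[O,C_1]+[O,C_2]s+\dots+[O,C_{\nu-1}]s^{\nu-2}+C_\nu s^{\nu-1},$$ where each $[O,C_i]$ is $r\times r$. Theorem. A reduction of $(A,B)$ to Yokoyama's canonical form exists. For every such reduction, $\det C_\nu\ne0$. Let $\begin{bmatrix}E\\ \hat T\end{bmatrix}$ be the $(n-r)\times(n-r)$ matrix in which $$E=\begin{bmatrix} O&E_{1,2}&O&\cdots&O\\ O&O&E_{2,3}&\cdots&O\\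 \vdots&\vdots&\vdots&\ddots&\vdots\\ O&O&O&\cdots&E_{\nu-2,\nu-1}\end{bmatrix}$$ is $(n-r-l_{\nu-1})\times(n-r)$ and $\hat T$ is the $l_{\nu-1}\times(n-r)$ matrix $$\hat T=\begin{cases}-C_\nu^{-1}[C_1,\dots,C_{\nu-1}], & l_{\nu-1}=r,\\ -[O,I_{l_{\nu-1}}]\,C_\nu^{-1}[C_1,\dots,C_{\nu-1}], & l_{\nu-1}<r\end{cases}$$ (if $\nu=1$ the matrix is empty and its characteristic polynomial is $1$). Then $r\nu\ge n$ and $$\det\tilde C(s)=\det C_\nu\; s^{r\nu-n}\,\det\!\left(sI_{n-r}-\begin{bmatrix}E\\ \hat T\end{bmatrix}\right),$$ and the system zeros are exactly the eigenvalues of $\begin{bmatrix}E\\ \hat T\end{bmatrix}$, also when multiplicities (algebraic ones for the eigenvalues) are counted. -/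

import Mathlib

open Matrix Polynomial

namespace LTI

noncomputable section

/-! Linear time-invariant systems `x' = A x + B u`, `y = C x` with `n` states, `r` inputs and
`p` outputs. -/

/-! ### System zeros -/

/-- Rosenbrock's system matrix `P(s) = [sI - A, -B; C, O]`. -/
def systemMatrix {n r p : ℕ} (A : Matrix (Fin n) (Fin n) ℝ) (B : Matrix (Fin n) (Fin r) ℝ)
    (C : Matrix (Fin p) (Fin n) ℝ) : Matrix (Fin n ⊕ Fin p) (Fin n ⊕ Fin r) ℝ[X] :=
  fromBlocks ((X : ℝ[X]) • (1 : Matrix (Fin n) (Fin n) ℝ[X]) - A.map Polynomial.C)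
    (-(B.map Polynomial.C)) (C.map Polynomial.C) 0

/-- The minors of order `n + k` of `P(s)` that contain the first `n` rows and the first `n`
columns, together with `k` further rows and `k` further columns. -/
def zeroMinors {n r p : ℕ} (A : Matrix (Fin n) (Fin n) ℝ) (B : Matrix (Fin n) (Fin r) ℝ)
    (C : Matrix (Fin p) (Fin n) ℝ) (k : ℕ) : Set ℝ[X] :=
  {q | ∃ (e : Fin k ↪o Fin p) (f : Fin k ↪o Fin r),
    q = ((systemMatrix A B C).submatrix (Sum.map id e) (Sum.map id f)).det}

/-- The largest `k` for which some minor of order `n + k` of the above form is not identically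
zero (the set is non-empty, as it contains `0`, and is bounded by `min p r`). -/
def maxMinorOrder {n r p : ℕ} (A : Matrix (Fin n) (Fin n) ℝ) (B : Matrix (Fin n) (Fin r) ℝ)
    (C : Matrix (Fin p) (Fin n) ℝ) : ℕ :=
  sSup {k | ∃ q ∈ zeroMinors A B C k, q ≠ 0}

/-- The zero polynomial `ψ(s)`: a greatest common divisor (in the principal ideal domain `ℝ[X]`,
hence a generator of the ideal spanned) of the non identically zero minors of maximal order. -/
def zeroPolynomial {n r p : ℕ} (A : Matrix (Fin n) (Fin n) ℝ) (B : Matrix (Fin n) (Fin r) ℝ)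
    (C : Matrix (Fin p) (Fin n) ℝ) : ℝ[X] :=
  Submodule.IsPrincipal.generator
    (Ideal.span {q | q ∈ zeroMinors A B C (maxMinorOrder A B C) ∧ q ≠ 0})

/-- The complete set of system zeros: the complex zeros of `ψ(s)`, with multiplicities. -/
def systemZeros {n r p : ℕ} (A : Matrix (Fin n) (Fin n) ℝ) (B : Matrix (Fin n) (Fin r) ℝ)
    (C : Matrix (Fin p) (Fin n) ℝ) : Multiset ℂ :=
  (zeroPolynomial A B C).aroots ℂ

/-! ### Controllability characteristics of a pair `(A, B)` -/

/-- The block matrix `[B, AB, …, A^(k-1) B]`. -/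
def ctrbMatrix {n r : ℕ} (A : Matrix (Fin n) (Fin n) ℝ) (B : Matrix (Fin n) (Fin r) ℝ) (k : ℕ) :
    Matrix (Fin n) (Fin k × Fin r) ℝ :=
  of fun a c => (A ^ (c.1 : ℕ) * B) a c.2

/-- Controllability of the pair `(A, B)`: `rank [B, AB, …, A^(n-1) B] = n`. -/
def IsControllable {n r : ℕ} (A : Matrix (Fin n) (Fin n) ℝ) (B : Matrix (Fin n) (Fin r) ℝ) :
    Prop :=
  (ctrbMatrix A B n).rank = n

/-- The controllability index: the smallest `ν` such that
`rank [B, AB, …, A^(n-1) B] = rank [B, AB, …, A^(ν-1) B]`. -/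
def ctrbIndex {n r : ℕ} (A : Matrix (Fin n) (Fin n) ℝ) (B : Matrix (Fin n) (Fin r) ℝ) : ℕ :=
  sInf {k | (ctrbMatrix A B n).rank = (ctrbMatrix A B k).rank}

/-- The integers `l_i = rank [B, …, A^(ν-i) B] - rank [B, …, A^(ν-i-1) B]`, `i = 1, …, ν`
(in particular `l_ν = rank B`).  The subtraction of ranks is never truncated. -/
def blockSize {n r : ℕ} (A : Matrix (Fin n) (Fin n) ℝ) (B : Matrix (Fin n) (Fin r) ℝ) (i : ℕ) :
    ℕ :=
  (ctrbMatrix A B (ctrbIndex A B - i + 1)).rank - (ctrbMatrix A B (ctrbIndex A B - i)).rank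

/-! ### Block matrices

Below `m` plays the role of `ν - 1`, and `l : ℕ → ℕ` gives the block sizes `l 1, …, l m`; the last
block, number `m + 1 = ν`, has size `r`. -/

/-- Indices of the blocks `1, …, m`, of sizes `l 1, …, l m`.  The index `i : Fin m` stands for
block number `i + 1`. -/
abbrev Head (m : ℕ) (l : ℕ → ℕ) : Type := (i : Fin m) × Fin (l (i + 1))

/-- The `p × q` matrix `[O, I_p]` (for `p ≤ q`): the entry in row `a` is in column
`b = a + (q - p)`.  For `p = q` it is the identity matrix, see `padId_self`. -/
def padId (p q : ℕ) : Matrix (Fin p) (Fin q) ℝ :=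
  of fun a b => if (a : ℕ) + q = b + p then 1 else 0

theorem padId_self (p : ℕ) : padId p p = 1 := by
  ext a b
  simp [padId, Matrix.one_apply, Fin.ext_iff]

/-- The square block matrix on the blocks `1, …, m` whose blocks `(i, i+1)` are
`E_{i,i+1} = [O, I_{l_i}]`, `i = 1, …, m - 1`, all other blocks being zero. -/
def shift (m : ℕ) (l : ℕ → ℕ) : Matrix (Head m l) (Head m l) ℝ :=
  of fun x y => if (y.1 : ℕ) = x.1 + 1 then padId (l (x.1 + 1)) (l (y.1 + 1)) x.2 y.2 else 0

/-- The block column on the blocks `1, …, m` whose last block is `E_{m,m+1} = [O, I_{l_m}]`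
(with `r` columns), all other blocks being zero. -/
def shiftLast (m : ℕ) (l : ℕ → ℕ) (r : ℕ) : Matrix (Head m l) (Fin r) ℝ :=
  of fun x b => if (x.1 : ℕ) + 1 = m then padId (l (x.1 + 1)) r x.2 b else 0

/-- The first block rows of a general block companion matrix: the block rows `i = 1, …, m` have
`E_{i,i+1} = [O, I_{l_i}]` in block column `i + 1` and zeros elsewhere. -/
def companionTop (m : ℕ) (l : ℕ → ℕ) (r : ℕ) : Matrix (Head m l) (Head m l ⊕ Fin r) ℝ :=
  fromCols (shift m l) (shiftLast m l r)

/-- The matrix `-[O, I_q] Cν⁻¹ [C_1, …, C_m]`, with `q` rows.  As `[O, I_r] = I_r`, for `q = r`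
it is `-Cν⁻¹ [C_1, …, C_m]`. -/
def hatT {m : ℕ} {l : ℕ → ℕ} {r : ℕ} (q : ℕ) (Ch : Matrix (Fin r) (Head m l) ℝ)
    (Cν : Matrix (Fin r) (Fin r) ℝ) : Matrix (Fin q) (Head m l) ℝ :=
  -(padId q r * Cν⁻¹ * Ch)

/-- The matrix `[E; T̂]`: the block rows `1, …, m - 1` are those of `E` (the block `E_{i,i+1}` in
block column `i + 1`, zeros elsewhere), and the last block row, of `l m` rows, is `T̂`. -/
def stackET {m : ℕ} {l : ℕ → ℕ} {r : ℕ} (Ch : Matrix (Fin r) (Head m l) ℝ)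
    (Cν : Matrix (Fin r) (Fin r) ℝ) : Matrix (Head m l) (Head m l) ℝ :=
  of fun x y =>
    if (x.1 : ℕ) + 1 = m then hatT (l (x.1 + 1)) Ch Cν x.2 y else shift m l x y

/-- The matrix polynomial `[O, C_1] + [O, C_2] s + ⋯ + [O, C_m] s^(m-1) + Cν s^m`, where
`[O, C_i] = C_i [O, I_{l_i}]` is `r × r`. -/
def polyC {m : ℕ} {l : ℕ → ℕ} {r : ℕ} (Ch : Matrix (Fin r) (Head m l) ℝ)
    (Cν : Matrix (Fin r) (Fin r) ℝ) : Matrix (Fin r) (Fin r) ℝ[X] :=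
  (∑ i : Fin m, (X : ℝ[X]) ^ (i : ℕ) •
      ((of fun (a : Fin r) (b : Fin (l (i + 1))) => Ch a ⟨i, b⟩) * padId (l (i + 1)) r).map
        Polynomial.C)
    + (X : ℝ[X]) ^ m • Cν.map Polynomial.C

/-! ### Reduction to Yokoyama's canonical form -/

/-- Indices of the first `ν - 1` blocks, of sizes `l_1, …, l_{ν-1}`. -/
abbrev HeadIdx {n r : ℕ} (A : Matrix (Fin n) (Fin n) ℝ) (B : Matrix (Fin n) (Fin r) ℝ) : Type :=
  Head (ctrbIndex A B - 1) (blockSize A B)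

/-- Indices of the transformed state: the blocks of sizes `l_1, …, l_{ν-1}` and then the last
block, of size `l_ν = r`. -/
abbrev StateIdx {n r : ℕ} (A : Matrix (Fin n) (Fin n) ℝ) (B : Matrix (Fin n) (Fin r) ℝ) : Type :=
  HeadIdx A B ⊕ Fin r

/-- `z = N x`, `v = M⁻¹ u` (with `N` nonsingular, of inverse `N'`, and `M` a permutation matrix)
is a reduction of the pair `(A, B)` to Yokoyama's canonical form `F = N A N⁻¹`, `G = N B M`. -/
structure IsYokoyamaReduction {n r : ℕ} (A : Matrix (Fin n) (Fin n) ℝ)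
    (B : Matrix (Fin n) (Fin r) ℝ) (N : Matrix (StateIdx A B) (Fin n) ℝ)
    (N' : Matrix (Fin n) (StateIdx A B) ℝ) (M : Matrix (Fin r) (Fin r) ℝ) : Prop where
  mul_inv : N * N' = 1
  inv_mul : N' * N = 1
  perm : ∃ σ : Equiv.Perm (Fin r), M = σ.permMatrix ℝ
  /-- `F` is a general block companion matrix; its last block row is arbitrary. -/
  companion : (N * A * N').toRows₁ = companionTop (ctrbIndex A B - 1) (blockSize A B) r
  /-- `G = [O; G_ν]`. -/
  input_top : (N * B * M).toRows₁ = 0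
  /-- `G_ν` is lower triangular by blocks, with identity matrices of orders `l_ν - l_{ν-1}`,
  `l_{ν-1} - l_{ν-2}`, …, `l_2 - l_1`, `l_1` on the diagonal.  The hypothesis says that the block
  containing row `a` is not below the block (in the same partition) of column `b`: the starting
  points of the blocks are the numbers `r - l_i`. -/
  input_last : ∀ a b : Fin r,
    (∀ i, 1 ≤ i → i < ctrbIndex A B → r ≤ a + blockSize A B i → r ≤ b + blockSize A B i) →
      (N * B * M).toRows₂ a b = if a = b then 1 else 0

/-- `[C_1, …, C_{ν-1}]`, where `C N⁻¹ = [C_1, …, C_ν]`. -/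
def outHead {n r : ℕ} {A : Matrix (Fin n) (Fin n) ℝ} {B : Matrix (Fin n) (Fin r) ℝ}
    (C : Matrix (Fin r) (Fin n) ℝ) (N' : Matrix (Fin n) (StateIdx A B) ℝ) :
    Matrix (Fin r) (HeadIdx A B) ℝ :=
  (C * N').toCols₁

/-- `C_ν`, where `C N⁻¹ = [C_1, …, C_ν]`. -/
def outLast {n r : ℕ} {A : Matrix (Fin n) (Fin n) ℝ} {B : Matrix (Fin n) (Fin r) ℝ}
    (C : Matrix (Fin r) (Fin n) ℝ) (N' : Matrix (Fin n) (StateIdx A B) ℝ) :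
    Matrix (Fin r) (Fin r) ℝ :=
  (C * N').toCols₂

/-- The matrix polynomial `C̃(s)` of the system. -/
def systemPolyC {n r : ℕ} {A : Matrix (Fin n) (Fin n) ℝ} {B : Matrix (Fin n) (Fin r) ℝ}
    (C : Matrix (Fin r) (Fin n) ℝ) (N' : Matrix (Fin n) (StateIdx A B) ℝ) :
    Matrix (Fin r) (Fin r) ℝ[X] :=
  polyC (outHead C N') (outLast C N')

/-- The matrix `[E; T̂]` of the system. -/
def systemET {n r : ℕ} {A : Matrix (Fin n) (Fin n) ℝ} {B : Matrix (Fin n) (Fin r) ℝ}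
    (C : Matrix (Fin r) (Fin n) ℝ) (N' : Matrix (Fin n) (StateIdx A B) ℝ) :
    Matrix (HeadIdx A B) (HeadIdx A B) ℝ :=
  stackET (outHead C N') (outLast C N')

end

end LTI

namespace LTI

noncomputable section

/-! ### Block matrices with blocks `[O, I]` -/

/-! Everything passes through one matrix, `pencil`: Π(s) = [sI - S, -L; C_h, C_ν], where [S, L] are
the companion block rows and C_h = [C_1, …, C_{ν-1}]. In canonical coordinates the inputs enter only
the last state block, through G_ν. Exchanging that block row with the output rows makes P(s) block
triangular with diagonal blocks Π(s) and -G_ν (`det_systemMatrix_mul`). Since C_ν G_ν = CBM, both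
C_ν and G_ν are invertible, so det P and det Π agree up to a nonzero constant. For a square system
with det P ≠ 0, ψ is associated to det P. The determinant of Π is then evaluated twice. The Schur
complement of C_ν gives det C_ν · det(sI - [E; T̂]) (`det_pencil`). Column operations that use the
companion structure give s^{(ν-1)r} det Π = s^{n-r} det C̃ (`X_pow_mul_det_polyC`). For existence,
controllability indices μ_j are selected (`exists_ctrbIndices`). Each sorted index ρ_a receives a
row ξ_a dual to the top vectors A^{ρ_a-1} b_j, and the chains ξ_a, ξ_a A, …, ξ_a A^{ρ_a-1} are the
rows of N. A staircase argument shows that N is nonsingular (`vecMul_eq_zero_of_staircase`). -/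

theorem padId_mul_padId {p q : ℕ} (r : ℕ) (h : p ≤ q) :
    padId p q * padId q r = padId p r := by
  ext a b
  have ha := a.2
  rw [Matrix.mul_apply, Finset.sum_eq_single (⟨a + q - p, by omega⟩ : Fin q)]
  · simp only [padId, of_apply]
    rw [if_pos (by omega), one_mul]
    congr 1
    apply propext
    constructor <;> intro h <;> omega
  · intro c _ hc
    rw [padId, of_apply, if_neg, zero_mul]
    intro h'
    apply hc
    ext
    simp only
    omega
  · simp

/-- The inclusion of the last `p` of `r` indices. -/
def tailEmb {p r : ℕ} (h : p ≤ r) (c : Fin p) : Fin r := ⟨c + (r - p), by omega⟩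

theorem tailEmb_injective {p r : ℕ} (h : p ≤ r) : Function.Injective (tailEmb h) := by
  intro a b hab
  simp only [tailEmb, Fin.mk.injEq] at hab
  ext
  omega

theorem padId_map_mul_apply {R κ : Type*} [CommRing R] (f : ℝ →+* R) {p r : ℕ} (h : p ≤ r)
    (Y : Matrix (Fin r) κ R) (c : Fin p) (k : κ) :
    ((padId p r).map f * Y) c k = Y (tailEmb h c) k := by
  rw [Matrix.mul_apply, Finset.sum_eq_single (tailEmb h c)]
  · simp only [padId, map_apply, of_apply, tailEmb]
    rw [if_pos (by omega), map_one, one_mul]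
  · intro b _ hb
    rw [padId, map_apply, of_apply, if_neg, map_zero, zero_mul]
    intro h'
    apply hb
    ext
    simp only [tailEmb]
    omega
  · simp

/-- The block column with blocks `[O, I_{l_i}] Y_i`. -/
def headStack {R κ : Type*} [CommRing R] (f : ℝ →+* R) (m : ℕ) (l : ℕ → ℕ) {r : ℕ}
    (Y : ℕ → Matrix (Fin r) κ R) : Matrix (Head m l) κ R :=
  of fun x k => ((padId (l (x.1 + 1)) r).map f * Y x.1) x.2 k

/-- Since the sizes increase, [O, I_{l_i}][O, I_{l_{i+1}}] = [O, I_{l_i}], so the companion rows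
move the stack up by one block. Used over ℝ[X] with Y_i = s^i I, and over ℝ with the rows of N. -/
theorem companionTop_mul_stack {R κ : Type*} [CommRing R] (f : ℝ →+* R) {m r : ℕ} {l : ℕ → ℕ}
    (hl : ∀ i, 1 ≤ i → i < m → l i ≤ l (i + 1)) (Y : ℕ → Matrix (Fin r) κ R) :
    (shift m l).map f * headStack f m l Y + (shiftLast m l r).map f * Y m =
      headStack f m l (fun i => Y (i + 1)) := by
  ext ⟨i, c⟩ k
  rw [Matrix.add_apply]
  by_cases hi : (i : ℕ) + 1 = m
  · have h1 : ((shift m l).map f * headStack f m l Y) ⟨i, c⟩ k = 0 := by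
      rw [Matrix.mul_apply]
      apply Finset.sum_eq_zero
      rintro ⟨j, d⟩ _
      have := j.2
      rw [map_apply, shift, of_apply, if_neg (by simp only; omega), map_zero, zero_mul]
    rw [h1, zero_add]
    simp only [Matrix.mul_apply, shiftLast, headStack, map_apply, of_apply, hi, if_true]
  · have h1 : ((shiftLast m l r).map f * Y m) ⟨i, c⟩ k = 0 := by
      simp [Matrix.mul_apply, shiftLast, hi]
    have him : (i : ℕ) + 1 < m := by have := i.2; omega
    rw [h1, add_zero, Matrix.mul_apply, Fintype.sum_sigma,
      Finset.sum_eq_single (⟨i + 1, him⟩ : Fin m)]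
    · simp only [shift, headStack, map_apply, of_apply, if_true]
      have := congrFun (congrFun (Matrix.mul_assoc ((padId (l (i + 1)) (l (i + 1 + 1))).map f)
        ((padId (l (i + 1 + 1)) r).map f) (Y (i + 1))) c) k
      rw [← Matrix.map_mul, padId_mul_padId _ (hl _ (by omega) him)] at this
      rw [this, Matrix.mul_apply]
      rfl
    · intro j _ hj
      apply Finset.sum_eq_zero
      intro d _
      rw [map_apply, shift, of_apply, if_neg, map_zero, zero_mul]
      intro h'
      exact hj (Fin.ext h')
    · simp

theorem shift_pow_apply_eq_zero (m : ℕ) (l : ℕ → ℕ) (k : ℕ) (x y : Head m l)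
    (h : (y.1 : ℕ) ≠ x.1 + k) : (shift m l ^ k) x y = 0 := by
  induction k generalizing y with
  | zero =>
    rw [pow_zero, Matrix.one_apply_ne]
    rintro rfl
    exact h rfl
  | succ k ih =>
    rw [pow_succ, Matrix.mul_apply]
    apply Finset.sum_eq_zero
    intro z _
    by_cases hz : (z.1 : ℕ) = x.1 + k
    · rw [shift, of_apply, if_neg (by omega), mul_zero]
    · rw [ih z hz, zero_mul]

/-- The k-th power is supported on the k-th block superdiagonal, so the matrix is nilpotent. -/
theorem charpoly_shift (m : ℕ) (l : ℕ → ℕ) :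
    (shift m l).charpoly = X ^ Fintype.card (Head m l) := by
  have h : IsNilpotent (shift m l) := by
    refine ⟨m, ?_⟩
    ext x y
    rw [shift_pow_apply_eq_zero]
    · rfl
    · have := y.1.2
      omega
  exact sub_eq_zero.1 (isNilpotent_charpoly_sub_pow_of_isNilpotent h).eq_zero

/-! ### Two evaluations of the determinant of the pencil. -/

theorem smul_one_sub_map_C {ι : Type*} [DecidableEq ι] [Fintype ι] (A : Matrix ι ι ℝ) :
    (X : ℝ[X]) • (1 : Matrix ι ι ℝ[X]) - A.map Polynomial.C = A.charmatrix := by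
  simp [charmatrix, ← Matrix.smul_one_eq_diagonal]

/-- The matrix `[sI - S, -L; C_h, C_ν]`, where `[S, L]` are the first block rows of a general
block companion matrix. -/
def pencil {m : ℕ} {l : ℕ → ℕ} {r : ℕ} (Ch : Matrix (Fin r) (Head m l) ℝ)
    (Cν : Matrix (Fin r) (Fin r) ℝ) : Matrix (Head m l ⊕ Fin r) (Head m l ⊕ Fin r) ℝ[X] :=
  fromBlocks (shift m l).charmatrix (-((shiftLast m l r).map Polynomial.C))
    (Ch.map Polynomial.C) (Cν.map Polynomial.C)

/-- Only the last block row of L is nonzero, and there S vanishes; so the correction replaces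
exactly that block row by T̂. -/
theorem stackET_eq {m : ℕ} {l : ℕ → ℕ} {r : ℕ} (Ch : Matrix (Fin r) (Head m l) ℝ)
    (Cν : Matrix (Fin r) (Fin r) ℝ) :
    stackET Ch Cν = shift m l - shiftLast m l r * (Cν⁻¹ * Ch) := by
  ext x y
  by_cases hx : (x.1 : ℕ) + 1 = m
  · have h0 : shift m l x y = 0 := by
      have := y.1.2
      rw [shift, of_apply, if_neg (by omega)]
    rw [Matrix.sub_apply, h0, zero_sub]
    simp only [stackET, of_apply, hx, if_true, hatT, Matrix.neg_apply, Matrix.mul_assoc]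
    rw [Matrix.mul_apply, Matrix.mul_apply (M := shiftLast m l r)]
    simp [shiftLast, hx]
  · rw [Matrix.sub_apply, Matrix.mul_apply]
    simp [stackET, shiftLast, hx]

theorem det_pencil {m : ℕ} {l : ℕ → ℕ} {r : ℕ} (Ch : Matrix (Fin r) (Head m l) ℝ)
    (Cν : Matrix (Fin r) (Fin r) ℝ) (hC : Cν.det ≠ 0) :
    (pencil Ch Cν).det = Polynomial.C Cν.det * (stackET Ch Cν).charpoly := by
  have hu : IsUnit Cν.det := hC.isUnit
  have h : Cν.map Polynomial.C * Cν⁻¹.map Polynomial.C = 1 := by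
    rw [← Matrix.map_mul, Matrix.mul_nonsing_inv _ hu]
    simp
  let : Invertible (Cν.map Polynomial.C) := invertibleOfRightInverse _ _ h
  rw [pencil, det_fromBlocks₂₂, RingHom.map_det, charpoly, invOf_eq_right_inv h]
  congr 2
  rw [stackET_eq, ← smul_one_sub_map_C, ← smul_one_sub_map_C,
    Matrix.map_sub _ (fun a b => Polynomial.C_sub), Matrix.map_mul, Matrix.map_mul,
    Matrix.neg_mul, Matrix.neg_mul, Matrix.mul_assoc, sub_neg_eq_add, sub_sub_eq_add_sub]
  abel

/-- The column with blocks [O, I_{l_i}] s^{i-1} and s^m I is annihilated by [sI - S, -L] and sent to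
C̃(s) by [C_h, C_ν]. Taking it as the last block column of a right multiplier makes the pencil block
triangular. -/
theorem X_pow_mul_det_polyC {m : ℕ} {l : ℕ → ℕ} {r : ℕ}
    (hl : ∀ i, 1 ≤ i → i < m → l i ≤ l (i + 1))
    (Ch : Matrix (Fin r) (Head m l) ℝ) (Cν : Matrix (Fin r) (Fin r) ℝ) :
    X ^ Fintype.card (Head m l) * (polyC Ch Cν).det = X ^ (m * r) * (pencil Ch Cν).det := by
  let Y : ℕ → Matrix (Fin r) (Fin r) ℝ[X] := fun i => (X : ℝ[X]) ^ i • 1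
  let Z := headStack Polynomial.C m l Y
  have hZ : (shift m l).charmatrix * Z + -((shiftLast m l r).map Polynomial.C) * Y m = 0 := by
    have h1 := companionTop_mul_stack Polynomial.C hl Y
    have h2 : headStack Polynomial.C m l (fun i => Y (i + 1)) = (X : ℝ[X]) • Z := by
      ext x k : 1
      simp only [headStack, of_apply, Y, Z, pow_succ', Matrix.smul_apply, Matrix.mul_smul,
        smul_eq_mul, mul_assoc]
    rw [h2] at h1
    rw [← smul_one_sub_map_C, Matrix.sub_mul, Matrix.smul_mul, Matrix.one_mul, ← h1,
      Matrix.neg_mul]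
    abel
  have hP : Ch.map Polynomial.C * Z + Cν.map Polynomial.C * Y m = polyC Ch Cν := by
    rw [polyC]
    congr 1
    · ext a b : 1
      rw [Matrix.mul_apply, Fintype.sum_sigma, Matrix.sum_apply]
      apply Finset.sum_congr rfl
      intro i _
      simp only [Z, headStack, Y, of_apply, Matrix.mul_smul, Matrix.mul_one, Matrix.smul_apply]
      simp only [map_apply, of_apply, Matrix.mul_apply, smul_eq_mul, map_sum, map_mul,
        Finset.mul_sum]
      apply Finset.sum_congr rfl
      intro c _
      ring
    · simp [Y]
  have hmul : pencil Ch Cν * fromBlocks 1 Z 0 (Y m) =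
      fromBlocks (shift m l).charmatrix 0 (Ch.map Polynomial.C) (polyC Ch Cν) := by
    rw [pencil, fromBlocks_multiply, hZ, hP]
    simp
  have hdet := congrArg Matrix.det hmul
  rw [det_mul, det_fromBlocks_zero₁₂, det_fromBlocks_zero₂₁, det_one, one_mul] at hdet
  have hY : (Y m).det = X ^ (m * r) := by
    simp [Y, pow_mul]
  rw [← charpoly_shift, charpoly, ← hdet, hY, mul_comm]

/-! ### Controllability indices -/

section Indices

variable {n r : ℕ} (A : Matrix (Fin n) (Fin n) ℝ) (B : Matrix (Fin n) (Fin r) ℝ)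

/-- The column space of `[B, AB, …, A^(k-1) B]`. -/
def ctrbSpace (k : ℕ) : Submodule ℝ (Fin n → ℝ) :=
  Submodule.span ℝ (Set.range (ctrbMatrix A B k).col)

theorem finrank_ctrbSpace (k : ℕ) :
    Module.finrank ℝ (ctrbSpace A B k) = (ctrbMatrix A B k).rank :=
  (rank_eq_finrank_span_cols _).symm

theorem rank_ctrbMatrix_zero : (ctrbMatrix A B 0).rank = 0 := by
  rw [← finrank_ctrbSpace, ctrbSpace, Set.range_eq_empty, Submodule.span_empty, finrank_bot]

variable {A B} in
theorem col_mem_ctrbSpace {i k : ℕ} (h : i < k) (j : Fin r) :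
    (A ^ i * B).col j ∈ ctrbSpace A B k :=
  Submodule.subset_span ⟨(⟨i, h⟩, j), rfl⟩

variable {A B} in
theorem ctrbSpace_le_iff {k : ℕ} {W : Submodule ℝ (Fin n → ℝ)} :
    ctrbSpace A B k ≤ W ↔ ∀ i < k, ∀ j, (A ^ i * B).col j ∈ W := by
  refine ⟨fun h i hi j => h (col_mem_ctrbSpace hi j), fun h => Submodule.span_le.2 ?_⟩
  rintro _ ⟨⟨i, j⟩, rfl⟩
  exact h i i.2 j

theorem ctrbSpace_mono : Monotone (ctrbSpace A B) := fun _ _ h =>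
  ctrbSpace_le_iff.2 fun _ hi j => col_mem_ctrbSpace (hi.trans_le h) j

theorem rank_ctrbMatrix_mono : Monotone fun k => (ctrbMatrix A B k).rank := fun k k' h => by
  simp only [← finrank_ctrbSpace]
  exact Submodule.finrank_mono (ctrbSpace_mono A B h)

theorem ctrbSpace_succ (k : ℕ) : ctrbSpace A B (k + 1) =
    ctrbSpace A B k ⊔ Submodule.span ℝ (Set.range (A ^ k * B).col) := by
  apply le_antisymm
  · refine ctrbSpace_le_iff.2 fun i hi j => ?_
    rcases Nat.lt_succ_iff_lt_or_eq.1 hi with h | rfl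
    · exact Submodule.mem_sup_left (col_mem_ctrbSpace h j)
    · exact Submodule.mem_sup_right (Submodule.subset_span ⟨j, rfl⟩)
  · refine sup_le (ctrbSpace_mono A B k.le_succ) (Submodule.span_le.2 ?_)
    rintro _ ⟨j, rfl⟩
    exact col_mem_ctrbSpace k.lt_succ_self j

theorem mulVec_col_pow (k : ℕ) (j : Fin r) :
    A.mulVecLin ((A ^ k * B).col j) = (A ^ (k + 1) * B).col j := by
  rw [pow_succ', Matrix.mul_assoc]
  rfl

theorem ctrbSpace_le_comap (k : ℕ) :
    ctrbSpace A B k ≤ (ctrbSpace A B (k + 1)).comap A.mulVecLin :=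
  ctrbSpace_le_iff.2 fun i hi j => by
    rw [Submodule.mem_comap, mulVec_col_pow]
    exact col_mem_ctrbSpace (by omega) j

/-- The columns of `A^k B` modulo the column space of `[B, AB, …, A^(k-1) B]`. -/
def colMod (k : ℕ) (j : Fin r) : (Fin n → ℝ) ⧸ ctrbSpace A B k :=
  (ctrbSpace A B k).mkQ ((A ^ k * B).col j)

theorem span_range_colMod (k : ℕ) : Submodule.span ℝ (Set.range (colMod A B k)) =
    (ctrbSpace A B (k + 1)).map (ctrbSpace A B k).mkQ := by
  rw [ctrbSpace_succ, Submodule.map_sup, Submodule.mkQ_map_self, bot_sup_eq, Submodule.map_span,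
    ← Set.range_comp]
  rfl

theorem finrank_span_range_colMod (k : ℕ) :
    Module.finrank ℝ (Submodule.span ℝ (Set.range (colMod A B k))) =
      (ctrbMatrix A B (k + 1)).rank - (ctrbMatrix A B k).rank := by
  rw [span_range_colMod, ← finrank_ctrbSpace, ← finrank_ctrbSpace]
  have h := ((ctrbSpace A B k).mkQ.domRestrict (ctrbSpace A B (k + 1))).finrank_range_add_finrank_ker
  rw [LinearMap.range_domRestrict, LinearMap.ker_domRestrict, Submodule.ker_mkQ] at h
  have h' := (Submodule.submoduleOfEquivOfLe (ctrbSpace_mono A B k.le_succ)).finrank_eq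
  rw [Submodule.submoduleOf] at h'
  rw [← h, h', Nat.add_sub_cancel]

/-- Controllability indices: the vectors `A^k b_j` with `k < μ j` form, for each `k`, a basis of
the column space of `[B, …, A^k B]` modulo that of `[B, …, A^(k-1) B]`. -/
theorem exists_ctrbIndices (hAB : IsControllable A B) : ∃ μ : Fin r → ℕ,
    (∀ k, (Finset.univ.filter fun j => k < μ j).card =
      (ctrbMatrix A B (k + 1)).rank - (ctrbMatrix A B k).rank) ∧
    ∀ k, LinearIndepOn ℝ (colMod A B k) {j | k < μ j} := by
  -- `f k t` is a maximal subset of `t` on which the classes of A^k b_j are independent. Choosing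
  -- each set inside the previous one makes the sets nested.
  choose f hf₁ _ hf₂ hf₃ using fun k (t : Set (Fin r)) =>
    exists_linearIndepOn_extension (linearIndepOn_empty ℝ (colMod A B k)) (Set.empty_subset t)
  let S : ℕ → Set (Fin r) := fun k => Nat.rec (f 0 Set.univ) (fun k s => f (k + 1) s) k
  have hS : Antitone S := antitone_nat_of_succ_le fun k => hf₁ (k + 1) (S k)
  have hind : ∀ k, LinearIndepOn ℝ (colMod A B k) (S k) := by
    intro k
    cases k <;> exact hf₃ _ _
  have hspan : ∀ k j, colMod A B k j ∈ Submodule.span ℝ (colMod A B k '' S k) := by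
    intro k
    induction k with
    | zero => exact fun j => hf₂ 0 Set.univ ⟨j, trivial, rfl⟩
    | succ k ih =>
      intro j
      -- A induces a map between consecutive quotients, so the indices that span at level k still
      -- span at level k + 1, and shrinking inside `S k` loses nothing.
      let T := (ctrbSpace A B k).mapQ (ctrbSpace A B (k + 1)) A.mulVecLin (ctrbSpace_le_comap A B k)
      have hT : ∀ j, T (colMod A B k j) = colMod A B (k + 1) j := by
        intro j
        simp only [T, colMod, Submodule.mkQ_apply, Submodule.mapQ_apply, mulVec_col_pow]
      have h := Submodule.mem_map_of_mem (f := T) (ih j)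
      rw [hT, Submodule.map_span, ← Set.image_comp] at h
      have h' : Submodule.span ℝ (T ∘ colMod A B k '' S k) ≤
          Submodule.span ℝ (colMod A B (k + 1) '' S (k + 1)) := by
        refine Submodule.span_le.2 ?_
        rintro _ ⟨i, hi, rfl⟩
        exact hf₂ (k + 1) (S k) ⟨i, hi, (hT i).symm⟩
      exact h' h
  clear_value S
  have hcard : ∀ k, (S k).ncard = (ctrbMatrix A B (k + 1)).rank - (ctrbMatrix A B k).rank := by
    intro k
    classical
    rw [← finrank_span_range_colMod]
    have h : Submodule.span ℝ (Set.range (colMod A B k)) =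
        Submodule.span ℝ (Set.range fun j : S k => colMod A B k j.1) := by
      rw [← Set.image_eq_range]
      apply le_antisymm
      · refine Submodule.span_le.2 ?_
        rintro _ ⟨j, rfl⟩
        exact hspan k j
      · exact Submodule.span_mono (Set.image_subset_range _ _)
    rw [h, finrank_span_eq_card (hind k), Set.ncard_eq_toFinset_card', Set.toFinset_card]
  -- By controllability the rank is already n, so the increment at n is zero.
  have hn : S n = ∅ := by
    have h := hcard n
    have h2 := (ctrbMatrix A B (n + 1)).rank_le_card_height
    rw [Fintype.card_fin] at h2
    have h3 : (ctrbMatrix A B n).rank = n := hAB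
    rw [h3] at h
    rw [← Set.ncard_eq_zero]
    omega
  classical
  have hex : ∀ j, ∃ k, j ∉ S k := fun j => ⟨n, by simp [hn]⟩
  let μ : Fin r → ℕ := fun j => Nat.find (hex j)
  have hμ : ∀ k, {j | k < μ j} = S k := by
    intro k
    ext j
    rw [Set.mem_ofPred_eq, Nat.lt_find_iff]
    exact ⟨fun h => not_not.1 (h k le_rfl), fun h i hi => not_not.2 (hS hi h)⟩
  refine ⟨μ, fun k => ?_, fun k => ?_⟩
  · rw [← hcard, ← hμ, Set.ncard_eq_toFinset_card']
    congr 1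
    ext j
    simp
  · rw [hμ]
    exact hind k

/-- The rank increments `rank [B, …, A^k B] - rank [B, …, A^(k-1) B]`. -/
def rankStep (k : ℕ) : ℕ := (ctrbMatrix A B (k + 1)).rank - (ctrbMatrix A B k).rank

variable {A B}

/-- The increments count the sets {j | k < μ j}, which shrink with k. -/
theorem rankStep_antitone (hAB : IsControllable A B) : Antitone (rankStep A B) := by
  obtain ⟨μ, hμ, -⟩ := exists_ctrbIndices A B hAB
  intro k k' h
  rw [rankStep, rankStep, ← hμ, ← hμ]
  refine Finset.card_le_card fun j => ?_
  simp only [Finset.mem_filter]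
  exact fun hj => ⟨hj.1, by omega⟩

theorem rankStep_le (hAB : IsControllable A B) (k : ℕ) : rankStep A B k ≤ r := by
  obtain ⟨μ, hμ, -⟩ := exists_ctrbIndices A B hAB
  rw [rankStep, ← hμ]
  exact (Finset.card_le_univ _).trans_eq (Fintype.card_fin r)

theorem sum_rankStep (k : ℕ) :
    ∑ i ∈ Finset.range k, rankStep A B i = (ctrbMatrix A B k).rank := by
  have h := Finset.sum_range_tsub (rank_ctrbMatrix_mono A B) k
  simp only [rank_ctrbMatrix_zero, Nat.sub_zero] at h
  exact h

theorem rank_ctrbMatrix_ctrbIndex (hAB : IsControllable A B) :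
    (ctrbMatrix A B (ctrbIndex A B)).rank = n := by
  have h : ctrbIndex A B ∈ {k | (ctrbMatrix A B n).rank = (ctrbMatrix A B k).rank} :=
    Nat.sInf_mem ⟨n, rfl⟩
  exact h.symm.trans hAB

theorem rankStep_zero (C : Matrix (Fin r) (Fin n) ℝ) (hCB : (C * B).det ≠ 0) :
    rankStep A B 0 = r := by
  rw [rankStep, rank_ctrbMatrix_zero, Nat.sub_zero, Nat.zero_add, ← finrank_ctrbSpace,
    ctrbSpace_succ]
  have h0 : ctrbSpace A B 0 = ⊥ := by
    rw [ctrbSpace, Set.range_eq_empty, Submodule.span_empty]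
  rw [h0, bot_sup_eq, ← rank_eq_finrank_span_cols, pow_zero, Matrix.one_mul]
  apply le_antisymm (rank_le_width B)
  calc r = (C * B).rank := by
        rw [rank_of_isUnit _ ((isUnit_iff_isUnit_det _).2 hCB.isUnit), Fintype.card_fin]
    _ ≤ B.rank := rank_mul_le_right C B

theorem ctrbIndex_pos (hr : 0 < r) (hAB : IsControllable A B) (C : Matrix (Fin r) (Fin n) ℝ)
    (hCB : (C * B).det ≠ 0) : 0 < ctrbIndex A B := by
  by_contra h
  have h0 : ctrbIndex A B = 0 := by omega
  have h1 := rank_ctrbMatrix_ctrbIndex hAB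
  rw [h0, rank_ctrbMatrix_zero] at h1
  subst h1
  have := (rankStep_zero (A := A) C hCB).symm.trans_le
    ((Nat.sub_le _ _).trans (rank_le_card_height _))
  simp at this
  omega

theorem card_headIdx (hr : 0 < r) (hAB : IsControllable A B) (C : Matrix (Fin r) (Fin n) ℝ)
    (hCB : (C * B).det ≠ 0) : Fintype.card (HeadIdx A B) + r = n := by
  have hν := ctrbIndex_pos hr hAB C hCB
  have h := sum_rankStep (A := A) (B := B) (ctrbIndex A B)
  obtain ⟨m, hm⟩ : ∃ m, ctrbIndex A B = m + 1 := ⟨_, (Nat.succ_pred_eq_of_pos hν).symm⟩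
  -- The increment at 0 is the last block, of size r; the remaining increments are the head blocks
  -- in reverse order.
  rw [rank_ctrbMatrix_ctrbIndex hAB, hm, Finset.sum_range_succ', rankStep_zero C hCB] at h
  refine Eq.trans ?_ h
  rw [Fintype.card_sigma]
  simp only [Fintype.card_fin]
  rw [Fin.sum_univ_eq_sum_range (fun i => blockSize A B (i + 1)), ← Finset.sum_range_reflect]
  congr 1
  refine Finset.sum_congr (by rw [hm, Nat.add_sub_cancel]) fun i hi => ?_
  have := Finset.mem_range.1 hi
  rw [blockSize, rankStep, hm]
  have h1 : m + 1 - (m + 1 - 1 - 1 - i + 1) = i + 1 := by omega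
  rw [h1]

theorem blockSize_eq_rankStep (i : ℕ) :
    blockSize A B i = rankStep A B (ctrbIndex A B - i) := rfl

theorem blockSize_mono (hAB : IsControllable A B) : Monotone (blockSize A B) := fun i j h =>
  rankStep_antitone hAB (by omega)

theorem le_mul_ctrbIndex (hAB : IsControllable A B) : n ≤ r * ctrbIndex A B := by
  have h := sum_rankStep (A := A) (B := B) (ctrbIndex A B)
  rw [rank_ctrbMatrix_ctrbIndex hAB] at h
  refine h.symm.trans_le ((Finset.sum_le_card_nsmul _ _ r fun i _ => rankStep_le hAB i).trans_eq ?_)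
  simp [mul_comm]

end Indices

/-! ### System zeros of a square system -/

section Zeros

variable {n r : ℕ} {A : Matrix (Fin n) (Fin n) ℝ} {B : Matrix (Fin n) (Fin r) ℝ}
  {C : Matrix (Fin r) (Fin n) ℝ}

theorem orderEmbedding_fin_eq_id (e : Fin r ↪o Fin r) : (e : Fin r → Fin r) = id := by
  refine (StrictMono.range_inj e.strictMono strictMono_id).1 ?_
  rw [Set.range_id, (Finite.injective_iff_surjective.1 e.injective).range_eq]

/-- The only order embedding of `Fin r` into itself is the identity. -/
theorem zeroMinors_self : zeroMinors A B C r = {(systemMatrix A B C).det} := by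
  have h : ∀ e f : Fin r ↪o Fin r,
      (systemMatrix A B C).submatrix (Sum.map id e) (Sum.map id f) = systemMatrix A B C := by
    intro e f
    rw [orderEmbedding_fin_eq_id e, orderEmbedding_fin_eq_id f, Sum.map_id_id, submatrix_id_id]
  ext q
  constructor
  · rintro ⟨e, f, rfl⟩
    rw [h]
    rfl
  · rintro rfl
    exact ⟨RelEmbedding.refl _, RelEmbedding.refl _, by rw [h]⟩

theorem maxMinorOrder_eq (hP : (systemMatrix A B C).det ≠ 0) : maxMinorOrder A B C = r := by
  refine IsGreatest.csSup_eq ⟨⟨_, zeroMinors_self.symm ▸ rfl, hP⟩, ?_⟩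
  rintro k ⟨_, ⟨e, -, -⟩, -⟩
  simpa using Fintype.card_le_of_injective e e.injective

theorem zeroPolynomial_associated (hP : (systemMatrix A B C).det ≠ 0) :
    Associated (zeroPolynomial A B C) (systemMatrix A B C).det := by
  have h : {q | q ∈ zeroMinors A B C (maxMinorOrder A B C) ∧ q ≠ 0} =
      {(systemMatrix A B C).det} := by
    rw [maxMinorOrder_eq hP, zeroMinors_self]
    ext q
    exact ⟨fun h => h.1, fun h => ⟨h, by rw [Set.mem_singleton_iff.1 h]; exact hP⟩⟩
  rw [← Ideal.span_singleton_eq_span_singleton, zeroPolynomial, Ideal.span_singleton_generator, h]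

theorem det_permMatrix_ne_zero {M : Matrix (Fin r) (Fin r) ℝ}
    (hM : ∃ σ : Equiv.Perm (Fin r), M = σ.permMatrix ℝ) : M.det ≠ 0 := by
  obtain ⟨σ, rfl⟩ := hM
  rw [det_permutation]
  exact Int.cast_ne_zero.2 (Units.ne_zero _)

namespace IsYokoyamaReduction

variable {N : Matrix (StateIdx A B) (Fin n) ℝ} {N' : Matrix (Fin n) (StateIdx A B) ℝ}
  {M : Matrix (Fin r) (Fin r) ℝ}

/-- Only the last block of NBM is nonzero. With det(CB) ≠ 0 this makes C_ν and G_ν invertible. -/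
theorem outLast_mul (h : IsYokoyamaReduction A B N N' M) (C : Matrix (Fin r) (Fin n) ℝ) :
    outLast C N' * (N * B * M).toRows₂ = C * B * M := by
  have h1 : C * B * M = C * N' * (N * B * M) := by
    rw [Matrix.mul_assoc C N', ← Matrix.mul_assoc N', ← Matrix.mul_assoc N', h.inv_mul,
      Matrix.one_mul, Matrix.mul_assoc]
  rw [h1, ← fromCols_toCols (C * N'), ← fromRows_toRows (N * B * M), fromCols_mul_fromRows,
    h.input_top, Matrix.mul_zero, zero_add, toRows₂_fromRows]
  rfl

theorem det_outLast_mul (h : IsYokoyamaReduction A B N N' M) (C : Matrix (Fin r) (Fin n) ℝ)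
    (hCB : (C * B).det ≠ 0) : (outLast C N').det * ((N * B * M).toRows₂).det ≠ 0 := by
  rw [← det_mul, h.outLast_mul, det_mul]
  exact mul_ne_zero hCB (det_permMatrix_ne_zero h.perm)

/-- The system matrix in the coordinates of the canonical form. -/
theorem systemMatrix_conj (h : IsYokoyamaReduction A B N N' M) (C : Matrix (Fin r) (Fin n) ℝ) :
    fromBlocks (N.map Polynomial.C) 0 0 (1 : Matrix (Fin r) (Fin r) ℝ[X]) *
        (systemMatrix A B C * fromBlocks 1 0 0 (M.map Polynomial.C)) *
        fromBlocks (N'.map Polynomial.C) 0 0 (1 : Matrix (Fin r) (Fin r) ℝ[X]) =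
      fromBlocks ((N * A * N').charmatrix) (-((N * B * M).map Polynomial.C))
        ((C * N').map Polynomial.C) 0 := by
  have h1 : N.map Polynomial.C * N'.map Polynomial.C = 1 := by
    rw [← Matrix.map_mul, h.mul_inv]
    simp
  rw [systemMatrix, fromBlocks_multiply, fromBlocks_multiply, fromBlocks_multiply,
    ← smul_one_sub_map_C]
  simp [Matrix.map_mul, Matrix.mul_sub, Matrix.sub_mul, Matrix.mul_assoc, h1]

/-- The exchange of the last two blocks. -/
def swapLast (α β : Type*) : Equiv.Perm ((α ⊕ β) ⊕ β) :=
  (Equiv.sumAssoc α β β).trans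
    ((Equiv.sumCongr (Equiv.refl α) (Equiv.sumComm β β)).trans (Equiv.sumAssoc α β β).symm)

/-- After the row exchange the arbitrary last block row of F lies below the diagonal, so it does not
affect the determinant. -/
theorem det_systemMatrix_mul (h : IsYokoyamaReduction A B N N' M)
    (C : Matrix (Fin r) (Fin n) ℝ) :
    (Equiv.Perm.sign (swapLast (HeadIdx A B) (Fin r)) : ℤ) *
        ((systemMatrix A B C).det * Polynomial.C M.det) =
      (pencil (outHead C N') (outLast C N')).det *
        Polynomial.C (-(N * B * M).toRows₂).det := by
  have hN : fromBlocks (N.map Polynomial.C) 0 0 (1 : Matrix (Fin r) (Fin r) ℝ[X]) *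
      fromBlocks (N'.map Polynomial.C) 0 0 (1 : Matrix (Fin r) (Fin r) ℝ[X]) = 1 := by
    rw [fromBlocks_multiply, ← Matrix.map_mul, h.mul_inv]
    simp
  have hN' : fromBlocks (N'.map Polynomial.C) 0 0 (1 : Matrix (Fin r) (Fin r) ℝ[X]) *
      fromBlocks (N.map Polynomial.C) 0 0 (1 : Matrix (Fin r) (Fin r) ℝ[X]) = 1 := by
    rw [fromBlocks_multiply, ← Matrix.map_mul, h.inv_mul]
    simp
  have hdet := congrArg Matrix.det (h.systemMatrix_conj C)
  rw [det_conj_of_mul_eq_one hN hN', det_mul, det_fromBlocks_zero₁₂, det_one, one_mul] at hdet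
  rw [RingHom.map_det, RingHom.map_det, RingHom.mapMatrix_apply, hdet, ← det_permute,
    ← det_fromBlocks_zero₁₂ _
      (of fun a y => (N * A * N').charmatrix (Sum.inr a) y)]
  congr 1
  ext i j : 1
  have hF : ∀ x y, (N * A * N') (Sum.inl x) y =
      companionTop (ctrbIndex A B - 1) (blockSize A B) r x y := fun x y =>
    congrFun (congrFun h.companion x) y
  have hG : ∀ x y, (N * B * M) (Sum.inl x) y = 0 := fun x y =>
    congrFun (congrFun h.input_top x) y
  rcases i with (x | a) | a <;> rcases j with (y | b) | b <;>
    simp [-Matrix.map_mul, swapLast, pencil, outHead, outLast, charmatrix_apply, hF, hG,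
      companionTop, diagonal_apply]

theorem det_systemMatrix_associated (h : IsYokoyamaReduction A B N N' M)
    (hCB : (C * B).det ≠ 0) :
    Associated (systemMatrix A B C).det (systemET C N').charpoly := by
  have hd := h.det_outLast_mul C hCB
  have h1 := h.det_systemMatrix_mul C
  rw [det_pencil _ _ (left_ne_zero_of_mul hd)] at h1
  have hu : IsUnit (((Equiv.Perm.sign (swapLast (HeadIdx A B) (Fin r)) : ℤ) : ℝ[X])) :=
    (Units.isUnit _).map (Int.castRingHom ℝ[X])
  have hM : IsUnit (Polynomial.C M.det) :=
    Polynomial.isUnit_C.2 (det_permMatrix_ne_zero h.perm).isUnit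
  have hG : IsUnit (Polynomial.C (-(N * B * M).toRows₂).det) := by
    refine Polynomial.isUnit_C.2 (IsUnit.mk0 _ ?_)
    rw [det_neg]
    exact mul_ne_zero (pow_ne_zero _ (by norm_num)) (right_ne_zero_of_mul hd)
  have hC : IsUnit (Polynomial.C (outLast C N').det) :=
    Polynomial.isUnit_C.2 (left_ne_zero_of_mul hd).isUnit
  calc Associated (systemMatrix A B C).det ((systemMatrix A B C).det * Polynomial.C M.det) :=
        (associated_mul_unit_left _ _ hM).symm
    Associated _ _ := (associated_unit_mul_left _ _ hu).symm
    Associated _ _ := Associated.of_eq h1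
    Associated _ _ := associated_mul_unit_left _ _ hG
    Associated _ _ := associated_unit_mul_left _ _ hC

theorem systemZeros_eq (h : IsYokoyamaReduction A B N N' M) (hCB : (C * B).det ≠ 0) :
    systemZeros A B C = (systemET C N').charpoly.aroots ℂ := by
  have h1 := h.det_systemMatrix_associated hCB
  have hP : (systemMatrix A B C).det ≠ 0 := fun h0 =>
    (charpoly_monic (systemET C N')).ne_zero ((h1.eq_zero_iff).1 h0)
  exact (((zeroPolynomial_associated hP).trans h1).map (mapRingHom (algebraMap ℝ ℂ))).roots_eq

theorem det_systemPolyC (h : IsYokoyamaReduction A B N N' M) (hr : 0 < r)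
    (hAB : IsControllable A B) (hCB : (C * B).det ≠ 0) :
    (systemPolyC C N').det =
      Polynomial.C (outLast C N').det * X ^ (r * ctrbIndex A B - n) *
        (systemET C N').charpoly := by
  have hcard := card_headIdx hr hAB C hCB
  have hle := le_mul_ctrbIndex hAB
  have hν : r * ctrbIndex A B = (ctrbIndex A B - 1) * r + r := by
    rw [← Nat.succ_mul, Nat.succ_eq_add_one, Nat.sub_add_cancel (ctrbIndex_pos hr hAB C hCB),
      mul_comm]
  have h1 := X_pow_mul_det_polyC (fun i _ _ => blockSize_mono hAB i.le_succ) (outHead C N')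
    (outLast C N')
  -- The head has n - r indices, so cancelling s^{n-r} leaves the exponent rν - n.
  have hpow : (ctrbIndex A B - 1) * r =
      Fintype.card (HeadIdx A B) + (r * ctrbIndex A B - n) := by
    omega
  rw [det_pencil _ _ (left_ne_zero_of_mul (h.det_outLast_mul C hCB)), hpow, pow_add,
    mul_assoc] at h1
  rw [systemPolyC, mul_left_cancel₀ (pow_ne_zero _ X_ne_zero) h1, systemET]
  ring

end IsYokoyamaReduction

theorem mem_aroots_charpoly_iff {ι : Type*} [Fintype ι] [DecidableEq ι] (T : Matrix ι ι ℝ)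
    (s : ℂ) : s ∈ T.charpoly.aroots ℂ ↔
      Module.End.HasEigenvalue (Matrix.toLin' (T.map (algebraMap ℝ ℂ))) s := by
  rw [Module.End.hasEigenvalue_iff_isRoot_charpoly, charpoly_toLin', charpoly_map, aroots_def,
    mem_roots ((charpoly_monic T).map _).ne_zero]

end Zeros

/-! ### Existence of the reduction -/

/-- For sorted values the set {k < ρ} is a final segment, hence determined by its size. This matches
chain lengths with the tails selected by [O, I]. -/
theorem _root_.Monotone.lt_apply_iff_le_add_card {r : ℕ} {ρ : Fin r → ℕ} (hρ : Monotone ρ)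
    (k : ℕ) (a : Fin r) : k < ρ a ↔ r ≤ a + (Finset.univ.filter fun b => k < ρ b).card := by
  constructor
  · intro h
    have hs : Finset.Ici a ⊆ Finset.univ.filter fun b => k < ρ b := fun b hb =>
      Finset.mem_filter.2 ⟨Finset.mem_univ _, h.trans_le (hρ (Finset.mem_Ici.1 hb))⟩
    have := Finset.card_le_card hs
    rw [Fin.card_Ici] at this
    omega
  · intro h
    by_contra hk
    have hs : (Finset.univ.filter fun b => k < ρ b) ⊆ Finset.Ioi a := fun b hb => by
      refine Finset.mem_Ioi.2 (lt_of_not_ge fun hba => hk ?_)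
      exact (Finset.mem_filter.1 hb).2.trans_le (hρ hba)
    have := Finset.card_le_card hs
    rw [Fin.card_Ioi] at this
    omega

theorem _root_.LinearIndependent.exists_linearMap_apply_eq {K V W ι : Type*} [Field K]
    [AddCommGroup V] [Module K V] [AddCommGroup W] [Module K W] {v : ι → V}
    (hv : LinearIndependent K v) (f : ι → W) : ∃ φ : V →ₗ[K] W, ∀ i, φ (v i) = f i := by
  obtain ⟨φ, hφ⟩ := LinearMap.exists_extend ((Module.Basis.span hv).constr K f)
  refine ⟨φ, fun i => ?_⟩
  have h := LinearMap.congr_fun hφ (Module.Basis.span hv i)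
  rw [Module.Basis.constr_basis, LinearMap.comp_apply, Submodule.subtype_apply,
    Module.Basis.span_apply] at h
  exact h

/-- Testing cN = 0 against H_0 leaves only the last block, against distinct rows of G. Against H_s,
blocks with m - i > s vanish by `h₁` and those with m - i < s have zero coefficients by induction,
so independence of the rows of G settles m - i = s. -/
theorem vecMul_eq_zero_of_staircase {m n r : ℕ} {l : ℕ → ℕ}
    {N : Matrix (Head m l ⊕ Fin r) (Fin n) ℝ} {H : ℕ → Matrix (Fin n) (Fin r) ℝ}
    {G : Matrix (Fin r) (Fin r) ℝ} (hG : G.det ≠ 0) {e : ∀ i : Fin m, Fin (l (i + 1)) → Fin r}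
    (he : ∀ i, Function.Injective (e i))
    (h₁ : ∀ (x : Head m l) (s : ℕ), s < m - x.1 → (N * H s) (Sum.inl x) = 0)
    (h₂ : ∀ x : Head m l, (N * H (m - x.1)) (Sum.inl x) = G (e x.1 x.2))
    (h₃ : ∀ a, (N * H 0) (Sum.inr a) = G a)
    {c : Head m l ⊕ Fin r → ℝ} (hc : c ᵥ* N = 0) : c = 0 := by
  have hrow : LinearIndependent ℝ G.row :=
    linearIndependent_rows_of_isUnit ((isUnit_iff_isUnit_det _).2 hG.isUnit)
  have hsum : ∀ s, ∑ x, c (Sum.inl x) • (N * H s) (Sum.inl x) +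
      ∑ a, c (Sum.inr a) • (N * H s) (Sum.inr a) = 0 := by
    intro s
    have h : c ᵥ* (N * H s) = 0 := by
      rw [← vecMul_vecMul, hc, zero_vecMul]
    rw [vecMul_eq_sum, Fintype.sum_sum_type] at h
    exact h
  have hlast : ∀ a, c (Sum.inr a) = 0 := by
    refine Fintype.linearIndependent_iff.1 hrow (fun a => c (Sum.inr a)) ?_
    have h := hsum 0
    rw [Finset.sum_eq_zero, zero_add] at h
    · refine Eq.trans (Finset.sum_congr rfl fun a _ => ?_) h
      rw [h₃]
      rfl
    · intro x _
      have := x.1.2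
      rw [h₁ x 0 (by omega), smul_zero]
  have hhead : ∀ s, ∀ x : Head m l, m - x.1 = s → c (Sum.inl x) = 0 := by
    intro s
    induction s using Nat.strong_induction_on with
    | _ s ih =>
      rintro ⟨i, d⟩ hi
      refine Fintype.linearIndependent_iff.1 (hrow.comp _ (he i))
        (fun d => c (Sum.inl ⟨i, d⟩)) ?_ d
      have h := hsum s
      rw [Fintype.sum_sigma, Finset.sum_eq_single i, Finset.sum_eq_zero (s := Finset.univ)
        (f := fun a => c (Sum.inr a) • (N * H s) (Sum.inr a)), add_zero] at h
      · rw [← h]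
        refine Finset.sum_congr rfl fun d _ => ?_
        have h' := h₂ ⟨i, d⟩
        rw [show m - (⟨i, d⟩ : Head m l).1 = s from hi] at h'
        rw [h']
        rfl
      · intro a _
        rw [hlast, zero_smul]
      · intro j _ hj
        refine Finset.sum_eq_zero fun d _ => ?_
        have := i.2
        have := j.2
        have hij : (j : ℕ) ≠ i := fun h => hj (Fin.ext h)
        simp only at hi
        rcases lt_or_gt_of_ne hij with hlt | hlt
        · rw [h₁ ⟨j, d⟩ s (by simp only; omega), smul_zero]
        · rw [ih (m - j) (by omega) ⟨j, d⟩ rfl, zero_smul]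
      · simp
  ext x
  rcases x with x | a
  · exact hhead _ x rfl
  · exact hlast a

section Existence

variable {n r : ℕ} {A : Matrix (Fin n) (Fin n) ℝ} {B : Matrix (Fin n) (Fin r) ℝ}

/-- A functional on the quotient by the column space of [B, …, A^{k-1}B] kills the lower columns
automatically and can be prescribed on independent classes. -/
theorem exists_row_of_linearIndepOn {k : ℕ} {J : Set (Fin r)}
    (hJ : LinearIndepOn ℝ (colMod A B k) J) (f : Fin r → ℝ) :
    ∃ ξ : Fin n → ℝ, (∀ s < k, ∀ j, ξ ⬝ᵥ (A ^ s * B).col j = 0) ∧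
      ∀ j ∈ J, ξ ⬝ᵥ (A ^ k * B).col j = f j := by
  obtain ⟨φ, hφ⟩ := hJ.exists_linearMap_apply_eq fun j => f j
  have h : ∀ w, (fun i => φ ((ctrbSpace A B k).mkQ (Pi.single i 1))) ⬝ᵥ w =
      φ ((ctrbSpace A B k).mkQ w) := by
    intro w
    have := LinearMap.pi_apply_eq_sum_univ (φ ∘ₗ (ctrbSpace A B k).mkQ) w
    rw [LinearMap.comp_apply] at this
    rw [this, dotProduct]
    refine Finset.sum_congr rfl fun i _ => ?_
    rw [smul_eq_mul, mul_comm, LinearMap.comp_apply]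
    congr 4
    ext j
    simp [Pi.single_apply, eq_comm]
  refine ⟨fun i => φ ((ctrbSpace A B k).mkQ (Pi.single i 1)), fun s hs j => ?_, fun j hj => ?_⟩
  · rw [h, Submodule.mkQ_apply,
      (Submodule.Quotient.mk_eq_zero _).2 (col_mem_ctrbSpace hs j), map_zero]
  · rw [h]
    exact hφ ⟨j, hj⟩

theorem exists_isYokoyamaReduction (hr : 0 < r) (hAB : IsControllable A B)
    (C : Matrix (Fin r) (Fin n) ℝ) (hCB : (C * B).det ≠ 0) :
    ∃ (N : Matrix (StateIdx A B) (Fin n) ℝ) (N' : Matrix (Fin n) (StateIdx A B) ℝ)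
      (M : Matrix (Fin r) (Fin r) ℝ), IsYokoyamaReduction A B N N' M := by
  obtain ⟨μ, hμ, hind⟩ := exists_ctrbIndices A B hAB
  set σ := Tuple.sort μ
  have hν := ctrbIndex_pos hr hAB C hCB
  set m := ctrbIndex A B - 1
  obtain ⟨ρ, hρ⟩ : ∃ ρ : Fin r → ℕ, ρ = μ ∘ σ := ⟨_, rfl⟩
  have hmono : Monotone ρ := hρ ▸ Tuple.monotone_sort μ
  have hlt : ∀ k a, k < ρ a ↔ r ≤ a + rankStep A B k := by
    intro k a
    rw [hmono.lt_apply_iff_le_add_card, rankStep, ← hμ k, hρ]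
    have : (Finset.univ.filter fun b => k < (μ ∘ σ) b).card =
        (Finset.univ.filter fun j => k < μ j).card :=
      Finset.card_equiv σ (by simp)
    rw [this]
  -- B has full column rank, so no chain is empty and ρ a - 1 is never truncated.
  have hpos : ∀ a, 0 < ρ a := fun a => (hlt 0 a).2 (by rw [rankStep_zero C hCB]; omega)
  have hle : ∀ a, ρ a ≤ ctrbIndex A B := by
    intro a
    have h0 : rankStep A B (ctrbIndex A B) = 0 := by
      have h := (ctrbMatrix A B (ctrbIndex A B + 1)).rank_le_card_height
      rw [rankStep, rank_ctrbMatrix_ctrbIndex hAB, Nat.sub_eq_zero_iff_le]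
      simpa using h
    have h := (hlt (ctrbIndex A B) a).not
    rw [h0] at h
    omega
  choose ξ hξ₁ hξ₂ using fun a : Fin r =>
    exists_row_of_linearIndepOn (hind (ρ a - 1)) (fun j => if σ a = j then 1 else 0)
  let Ξ : Matrix (Fin r) (Fin n) ℝ := of ξ
  have hΞ : ∀ s a j, (Ξ * (A ^ s * B)) a j = ξ a ⬝ᵥ (A ^ s * B).col j := fun _ _ _ => rfl
  -- Chain a fills the last ρ a blocks and ends with ξ_a A^{ρ a - 1} in block m (counted from 0).
  -- Where the outer subtraction truncates below zero, the row is not among those retained by [O,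
  -- I], by `htail`.
  let Y : ℕ → Matrix (Fin r) (Fin n) ℝ := fun i => of fun a => (Ξ * A ^ (ρ a - 1 - (m - i))) a
  have hY : ∀ {q : ℕ} (i : ℕ) (Z : Matrix (Fin n) (Fin q) ℝ) a j,
      (Y i * Z) a j = (Ξ * A ^ (ρ a - 1 - (m - i)) * Z) a j := fun _ _ _ _ => rfl
  have hYB : ∀ i s a j, (Y i * (A ^ s * B)) a j =
      ξ a ⬝ᵥ (A ^ (ρ a - 1 - (m - i) + s) * B).col j := by
    intro i s a j
    rw [hY, Matrix.mul_assoc, ← Matrix.mul_assoc (A ^ _), ← pow_add, hΞ]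
  let N : Matrix (StateIdx A B) (Fin n) ℝ :=
    fromRows (headStack (RingHom.id ℝ) m (blockSize A B) Y) (Y m)
  have hlr : ∀ i, blockSize A B i ≤ r := fun i => rankStep_le hAB _
  have hN : ∀ {q : ℕ} (x : HeadIdx A B) (Z : Matrix (Fin n) (Fin q) ℝ) k,
      (N * Z) (Sum.inl x) k = (Y x.1 * Z) (tailEmb (hlr _) x.2) k := by
    intro q x Z k
    rw [Matrix.mul_apply, Matrix.mul_apply]
    refine Finset.sum_congr rfl fun j _ => ?_
    congr 1
    exact padId_map_mul_apply (RingHom.id ℝ) (hlr _) (Y x.1) x.2 j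
  have hNr : ∀ {q : ℕ} (a : Fin r) (Z : Matrix (Fin n) (Fin q) ℝ) k,
      (N * Z) (Sum.inr a) k = (Y m * Z) a k := fun _ _ _ => rfl
  have htail : ∀ x : HeadIdx A B, m - x.1 < ρ (tailEmb (hlr _) x.2) := by
    intro x
    have h1 := hlr (x.1 + 1)
    rw [hlt]
    have h2 : blockSize A B (x.1 + 1) = rankStep A B (m - x.1) := by
      rw [blockSize_eq_rankStep]
      congr 1
      omega
    simp only [tailEmb]
    omega
  let G : Matrix (Fin r) (Fin r) ℝ := of fun a b => ξ a ⬝ᵥ (A ^ (ρ a - 1) * B).col (σ b)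
  have hG₁ : ∀ a b, ρ a - 1 < ρ b → G a b = if a = b then 1 else 0 := by
    intro a b h
    have := hξ₂ a (σ b) (by rw [hρ] at h ⊢; exact h)
    simp only [σ.injective.eq_iff] at this
    exact this
  have hGdet : G.det ≠ 0 := by
    have hlow : G.IsLowerTriangular := by
      -- For a < b sortedness gives ρ a - 1 < ρ b, so duality applies to the entry.
      intro a b hab
      have hab' : a < b := hab
      have := hmono hab'.le
      have := hpos a
      rw [hG₁ a b (by omega), if_neg hab'.ne]
    rw [det_of_isLowerTriangular _ hlow, Finset.prod_eq_one]
    · exact one_ne_zero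
    · intro a _
      have := hpos a
      rw [hG₁ a a (by omega), if_pos rfl]
  have hinj : ∀ c, c ᵥ* N = 0 → c = 0 := by
    intro c hc
    refine vecMul_eq_zero_of_staircase (H := fun s => A ^ s * B.submatrix id σ) hGdet
      (fun i => tailEmb_injective (hlr (i + 1))) ?_ ?_ ?_ hc
    · intro x s hs
      ext b
      have := htail x
      rw [hN]
      exact (hYB x.1 s _ (σ b)).trans (hξ₁ _ _ (by omega) _)
    · intro x
      ext b
      have := htail x
      rw [hN]
      refine (hYB x.1 (m - x.1) _ (σ b)).trans ?_
      rw [Nat.sub_add_cancel (by omega)]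
      rfl
    · intro a
      ext b
      rw [hNr]
      refine (hYB m 0 _ (σ b)).trans ?_
      rw [Nat.sub_self, Nat.sub_zero, Nat.add_zero]
      rfl
  have hcard : Fintype.card (StateIdx A B) = Fintype.card (Fin n) := by
    rw [Fintype.card_sum, Fintype.card_fin, Fintype.card_fin, card_headIdx hr hAB C hCB]
  obtain ⟨N', hN'⟩ : ∃ N' : Matrix (Fin n) (StateIdx A B) ℝ, N' * N = 1 := by
    rw [← vecMul_surjective_iff_exists_left_inverse]
    have h : Function.Injective N.vecMulLinear :=
      (injective_iff_map_eq_zero _).2 hinj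
    exact (LinearMap.injective_iff_surjective_of_finrank_eq_finrank (by simpa using hcard)).1 h
  have hNN' : N * N' = 1 := (mul_eq_one_comm_of_card_eq _ _ _ hcard).2 hN'
  have hNA : (N * A).toRows₁ = companionTop m (blockSize A B) r * N := by
    have h := companionTop_mul_stack (RingHom.id ℝ)
      (fun i _ _ => blockSize_mono hAB i.le_succ) (m := m) Y
    rw [companionTop, fromCols_mul_fromRows]
    refine Eq.trans ?_ h.symm
    ext x k
    have h1 := htail x
    have h2 := x.1.2
    refine (hN x A k).trans ?_
    refine Eq.trans ?_ (padId_map_mul_apply (RingHom.id ℝ) (hlr _) (Y (x.1 + 1)) x.2 k).symm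
    rw [hY, Matrix.mul_assoc, ← pow_succ]
    have h3 : ∀ a, m - x.1 < ρ a →
        ρ a - 1 - (m - x.1) + 1 = ρ a - 1 - (m - (x.1 + 1)) := by
      intro a ha
      omega
    rw [h3 _ h1]
    rfl
  have hM : B * (σ⁻¹).permMatrix ℝ = B.submatrix id σ := by
    rw [Equiv.Perm.permMatrix, PEquiv.mul_toMatrix_toPEquiv]
    rfl
  refine ⟨N, N', (σ⁻¹).permMatrix ℝ, hNN', hN', ⟨_, rfl⟩, ?_, ?_, ?_⟩
  · change (N * A).toRows₁ * N' = _
    rw [hNA, Matrix.mul_assoc, hNN', Matrix.mul_one]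
  · rw [Matrix.mul_assoc, hM]
    ext x b
    have h1 := htail x
    have h2 := x.1.2
    refine (hN x _ b).trans ?_
    have h := hYB x.1 0 (tailEmb (hlr _) x.2) (σ b)
    rw [pow_zero, Matrix.one_mul] at h
    exact h.trans (hξ₁ _ _ (by omega) _)
  · intro a b hab
    rw [Matrix.mul_assoc, hM]
    have h := hYB m 0 a (σ b)
    rw [pow_zero, Matrix.one_mul, Nat.sub_self, Nat.sub_zero, Nat.add_zero] at h
    refine Eq.trans h (hG₁ a b ?_)
    have hpa := hpos a
    have hla := hle a
    rcases Nat.eq_zero_or_pos (ρ a - 1) with h0 | h0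
    · rw [h0]
      exact hpos b
    -- For this i the block size l_i is the rank increment at ρ a - 1, so the block hypothesis
    -- reads: ρ a - 1 < ρ a implies ρ a - 1 < ρ b.
    · have hi := hab (ctrbIndex A B - (ρ a - 1)) (by omega) (by omega)
      rw [blockSize_eq_rankStep, Nat.sub_sub_self (by omega), ← hlt, ← hlt] at hi
      exact hi (by omega)

end Existence

end

end LTI

theorem theorem7p6 {n r : ℕ} (hr : 0 < r)
    (A : Matrix (Fin n) (Fin n) ℝ) (B : Matrix (Fin n) (Fin r) ℝ) (C : Matrix (Fin r) (Fin n) ℝ)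
    (hAB : LTI.IsControllable A B) (hCB : (C * B).det ≠ 0) :
    (∃ (N : Matrix (LTI.StateIdx A B) (Fin n) ℝ) (N' : Matrix (Fin n) (LTI.StateIdx A B) ℝ)
      (M : Matrix (Fin r) (Fin r) ℝ), LTI.IsYokoyamaReduction A B N N' M) ∧
    ∀ (N : Matrix (LTI.StateIdx A B) (Fin n) ℝ) (N' : Matrix (Fin n) (LTI.StateIdx A B) ℝ)
      (M : Matrix (Fin r) (Fin r) ℝ), LTI.IsYokoyamaReduction A B N N' M →
      -- the matrix `[E; T̂]` is square of order `n - r`, and `C_ν` is nonsingular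
      Fintype.card (LTI.HeadIdx A B) + r = n ∧
      (LTI.outLast C N').det ≠ 0 ∧
      -- `det C̃(s) = det C_ν * s ^ (rν - n) * det (sI - [E; T̂])`
      n ≤ r * LTI.ctrbIndex A B ∧
      (LTI.systemPolyC C N').det =
        Polynomial.C (LTI.outLast C N').det * Polynomial.X ^ (r * LTI.ctrbIndex A B - n) *
          (LTI.systemET C N').charpoly ∧
      -- the system zeros are the eigenvalues of `[E; T̂]`, also with multiplicities
      LTI.systemZeros A B C = (LTI.systemET C N').charpoly.aroots ℂ ∧
      ∀ s : ℂ, s ∈ LTI.systemZeros A B C ↔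
        Module.End.HasEigenvalue
          (Matrix.toLin' ((LTI.systemET C N').map (algebraMap ℝ ℂ))) s := by
  refine ⟨LTI.exists_isYokoyamaReduction hr hAB C hCB, fun N N' M h => ?_⟩
  refine ⟨LTI.card_headIdx hr hAB C hCB, left_ne_zero_of_mul (h.det_outLast_mul C hCB),
    LTI.le_mul_ctrbIndex hAB, h.det_systemPolyC hr hAB hCB, h.systemZeros_eq hCB, fun s => ?_⟩
  rw [h.systemZeros_eq hCB]
  exact LTI.mem_aroots_charpoly_iff _ s
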